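/- **The graph and its symmetry.** Consider the twelve edges $a_i,b_i,c_i$ ($i\in\{1,2,3,4\}$) of the bipartite ribbon graph $\Gamma_{\rm cube}$ (the 1-skeleton of the cube). The cyclic orders of the edges at the four $\circ$-vertices are $(a_4,a_1,c_1)$, $(b_2,b_1,c_2)$, $(a_2,a_3,c_3)$, $(b_4,b_3,c_4)$, and at the four $\bullet$-vertices $(b_1,b_4,c_1)$, $(a_1,a_2,c_2)$, $(b_3,b_2,c_3)$, $(a_3,a_4,c_4)$. The group $G$ of permutations of the edges that preserve the colours of the vertices and these cyclic orders is isomorphic to ${\rm A}_4$. **The torus and the subvariety.** Let $R$ be a skew field or, more generally, any unital associative ring. The $R$-points of the non-commutative torus ${\cal A}_{\rm cube}$ are the 12-tuples of elements $a_i,b_i,c_i\in R^\times$ such that $$a_4a_1c_1=b_2b_1c_2=a_2a_3c_3=b_4b_3c_4=-1,\qquad b_1b_4c_1=a_1a_2c_2=b_3b_2c_3=a_3a_4c_4=1. \tag{S14}$$ Let ${\Bbb L}\subset{\cal A}_{\rm cube}$ be the subvariety given by the twelve equations $$\begin{aligned} &a_4b_2+(c_3c_1)^{-1}=1, && b_2a_4+(c_4c_2)^{-1}=1,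 && a_2b_4+(c_1c_3)^{-1}=1, && b_4a_2+(c_2c_4)^{-1}=1,\\ &a_1b_3+(b_2a_4)^{-1}=1, && b_3a_1+(a_2b_4)^{-1}=1, && a_3b_1+(b_4a_2)^{-1}=1, && b_1a_3+(a_4b_2)^{-1}=1,\\ &c_1c_3+(b_3a_1)^{-1}=1, && c_3c_1+(b_1a_3)^{-1}=1, && c_2c_4+(a_3b_1)^{-1}=1, && c_4c_2+(a_1b_3)^{-1}=1. \end{aligned}\tag{S1}$$ **Tangent vectors and the 2-form.** For an $R$-point $x$ of ${\Bbb L}$ and an $R$-bimodule $M$, let $T_x{\cal A}_{\rm cube}(M)$ and $T_x{\Bbb L}(M)$ be the sets of families $s=(s_e)_e$ of elements of $M$, indexed by the twelve edges $e$, such that $x+\varepsilon s$ is a point of ${\cal A}_{\rm cube}$, respectively of ${\Bbb L}$, over the square-zero extension $R\oplus\varepsilon M$. Let $\langle\cdot,\cdot\rangle:M\times N\to Q$ be a biadditive pairing of two $R$-bimodules with values in an abelian group $Q$ that is cyclically invariant: $\langle mr,n\rangle=\langle m,rn\rangle$ and $\langle rm,n\rangle=\langle m,nr\rangle$ for all $r\in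 R$, $m\in M$, $n\in N$ (for $M=N=R$: $\langle m,n\rangle=mn$ in $R/[R,R]$). The canonical cyclic 2-form $$\Omega=\{a_4,a_1\}+\{b_2,b_1\}+\{a_2,a_3\}+\{b_4,b_3\}-\{b_1,b_4\}-\{a_1,a_2\}-\{b_3,b_2\}-\{a_3,a_4\},\qquad \{a,b\}=da\,db\,b^{-1}a^{-1},$$ takes values in $Q$ on $s$ (coefficients in $M$) and $t$ (coefficients in $N$), through $\{a,b\}(s,t)=\langle s_a,\,t_b b^{-1}a^{-1}\rangle-\langle s_b b^{-1}a^{-1},\,t_a\rangle$. **Theorem.** ${\Bbb L}$ is an ${\rm A}_4$-invariant Lagrangian subvariety of ${\cal A}_{\rm cube}$. That is, for every $R$: 1. Permuting coordinates by elements of $G\cong{\rm A}_4$ preserves ${\cal A}_{\rm cube}(R)$ and ${\Bbb L}(R)$. Moreover ${\Bbb L}(R)$ is non-empty if and only if there is $r\in R^\times$ with $1-r$ invertible (for a skew field: if and only if $R$ has more than two elements). 2. ${\Bbb L}$ is isotropic: at every $x\in{\Bbb L}(R)$, for all $M,N,Q$ and every cyclically invariant pairing as above, $\Omega(s,t)=0$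 for all $s\in T_x{\Bbb L}(M)$, $t\in T_x{\Bbb L}(N)$. 3. ${\Bbb L}$ is maximal isotropic: if moreover only $m=0$ satisfies $\langle m,n\rangle=0$ for all $n\in N$, and $M$ has no 2-torsion (automatic if $2$ is invertible in $R$), then every $s\in T_x{\cal A}_{\rm cube}(M)$ with $\Omega(s,t)=0$ for all $t\in T_x{\Bbb L}(N)$ lies in $T_x{\Bbb L}(M)$. -/

import Mathlib

open scoped RightActions

universe u v w z

/-- The twelve edges of the cube, named after the coordinates placed on them. -/
inductive CubeEdge
  | a1 | a2 | a3 | a4 | b1 | b2 | b3 | b4 | c1 | c2 | c3 | c4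
  deriving DecidableEq

namespace CubeEdge

/-- The edge following `e` in the cyclic order at the `∘`-vertex of `e`.  The four `∘`-vertices are
`(a4 a1 c1)`, `(b2 b1 c2)`, `(a2 a3 c3)`, `(b4 b3 c4)`. -/
def nextWhite : CubeEdge → CubeEdge
  | a4 => a1 | a1 => c1 | c1 => a4
  | b2 => b1 | b1 => c2 | c2 => b2
  | a2 => a3 | a3 => c3 | c3 => a2
  | b4 => b3 | b3 => c4 | c4 => b4

/-- The edge following `e` in the cyclic order at the `•`-vertex of `e`.  The four `•`-vertices are
`(b1 b4 c1)`, `(a1 a2 c2)`, `(b3 b2 c3)`, `(a3 a4 c4)`. -/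
def nextBlack : CubeEdge → CubeEdge
  | b1 => b4 | b4 => c1 | c1 => b1
  | a1 => a2 | a2 => c2 | c2 => a1
  | b3 => b2 | b2 => c3 | c3 => b3
  | a3 => a4 | a4 => c4 | c4 => a3

end CubeEdge

open CubeEdge

/-- The automorphism group of the bipartite ribbon graph of the cube: the permutations of the
edges that respect the colours of the vertices and the cyclic orders at the vertices.  These are
the rotations of the cube that preserve the two-colouring of its vertices. -/
def cubeSymmetry : Subgroup (Equiv.Perm CubeEdge) where
  carrier := {g | ∀ e, g (nextWhite e) = nextWhite (g e) ∧ g (nextBlack e) = nextBlack (g e)}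
  one_mem' := fun _ => ⟨rfl, rfl⟩
  mul_mem' := by
    intro g h hg hh e
    simp only [Equiv.Perm.mul_apply]
    rw [(hh e).1, (hh e).2, (hg (h e)).1, (hg (h e)).2]
    exact ⟨rfl, rfl⟩
  inv_mem' := by
    intro g hg e
    constructor
    · rw [Equiv.Perm.inv_eq_iff_eq, (hg _).1]; simp
    · rw [Equiv.Perm.inv_eq_iff_eq, (hg _).2]; simp

/-- The `R`-points of the non-commutative torus of the cube: invertible edge variables whose ordered
product is `-1` around every `∘`-vertex and `1 = (-1) ^ (3 - 1)` around every `•`-vertex. -/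
def cubeTorus (R : Type u) [Ring R] : Set (CubeEdge → Rˣ) :=
  {x | x a4 * x a1 * x c1 = -1 ∧ x b2 * x b1 * x c2 = -1 ∧
       x a2 * x a3 * x c3 = -1 ∧ x b4 * x b3 * x c4 = -1 ∧
       x b1 * x b4 * x c1 = 1 ∧ x a1 * x a2 * x c2 = 1 ∧
       x b3 * x b2 * x c3 = 1 ∧ x a3 * x a4 * x c4 = 1}

/-- The expression `e f + (g h)⁻¹` at the point `x`. -/
def edgeSum {R : Type u} [Ring R] (x : CubeEdge → Rˣ) (e f g h : CubeEdge) : R :=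
  (x e : R) * (x f : R) + (((x g * x h)⁻¹ : Rˣ) : R)

/-- The `R`-points of the subvariety of the non-commutative torus cut out by the twelve
equations. -/
def cubeLagrangian (R : Type u) [Ring R] : Set (CubeEdge → Rˣ) :=
  {x | x ∈ cubeTorus R ∧
    (edgeSum x a4 b2 c3 c1 = 1 ∧ edgeSum x b2 a4 c4 c2 = 1 ∧
     edgeSum x a2 b4 c1 c3 = 1 ∧ edgeSum x b4 a2 c2 c4 = 1) ∧
    (edgeSum x a1 b3 b2 a4 = 1 ∧ edgeSum x b3 a1 a2 b4 = 1 ∧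
     edgeSum x a3 b1 b4 a2 = 1 ∧ edgeSum x b1 a3 a4 b2 = 1) ∧
    (edgeSum x c1 c3 b3 a1 = 1 ∧ edgeSum x c3 c1 b1 a3 = 1 ∧
     edgeSum x c2 c4 a3 b1 = 1 ∧ edgeSum x c4 c2 a1 b3 = 1)}

section Tangent

variable {R : Type u} [Ring R]

/-- Tangent vectors at `x` with coefficients in an `R`-bimodule `M`, for a system of equations whose
set of points over the square-zero extension `R ⊕ ε M` is `X`: the families `v` such that
`x + ε v` belongs to `X`. -/
def tangentVectors {M : Type v} [AddCommGroup M] [Module R M] [Module Rᵐᵒᵖ M]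
    [SMulCommClass R Rᵐᵒᵖ M] (X : Set (CubeEdge → (TrivSqZeroExt R M)ˣ)) (x : CubeEdge → Rˣ) :
    Set (CubeEdge → M) :=
  {t | ∃ y ∈ X, ∀ e, (y e : TrivSqZeroExt R M) =
    TrivSqZeroExt.inl (x e : R) + TrivSqZeroExt.inr (t e)}

/-- The tangent space at `x` of the non-commutative torus of the cube, with coefficients in the
bimodule `M`. -/
def cubeTorusTangent (x : CubeEdge → Rˣ) (M : Type v) [AddCommGroup M] [Module R M]
    [Module Rᵐᵒᵖ M] [SMulCommClass R Rᵐᵒᵖ M] : Set (CubeEdge → M) :=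
  tangentVectors (cubeTorus (TrivSqZeroExt R M)) x

/-- The tangent space at `x` of the subvariety given by the twelve equations, with coefficients in
the bimodule `M`. -/
def cubeLagrangianTangent (x : CubeEdge → Rˣ) (M : Type v) [AddCommGroup M] [Module R M]
    [Module Rᵐᵒᵖ M] [SMulCommClass R Rᵐᵒᵖ M] : Set (CubeEdge → M) :=
  tangentVectors (cubeLagrangian (TrivSqZeroExt R M)) x

end Tangent

/-- A biadditive pairing of two `R`-bimodules that is invariant under cyclic shifts, that is, an
additive map on the cyclic tensor product `M ⊗ N / (m r ⊗ n - m ⊗ r n, r m ⊗ n - m ⊗ n r)`.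
For `M = N = R` these are the maps `(m, n) ↦ τ (m n)` with `τ` additive on `R / [R, R]`. -/
structure CyclicPairing (R : Type u) [Ring R] (M : Type v) (N : Type w) (Q : Type z)
    [AddCommGroup M] [Module R M] [Module Rᵐᵒᵖ M] [AddCommGroup N] [Module R N] [Module Rᵐᵒᵖ N]
    [AddCommGroup Q] where
  /-- The underlying biadditive map. -/
  pair : M →+ N →+ Q
  pair_right_smul : ∀ (m : M) (r : R) (n : N), pair (m <• r) n = pair m (r • n)
  pair_left_smul : ∀ (m : M) (r : R) (n : N), pair (r • m) n = pair m (n <• r)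

section Form

variable {R : Type u} [Ring R] {M : Type v} {N : Type w} {Q : Type z}
  [AddCommGroup M] [Module R M] [Module Rᵐᵒᵖ M] [AddCommGroup N] [Module R N] [Module Rᵐᵒᵖ N]
  [AddCommGroup Q]

/-- Only `0` pairs trivially with all of `N`. -/
def CyclicPairing.Nondegenerate (B : CyclicPairing R M N Q) : Prop :=
  ∀ m : M, (∀ n : N, B.pair m n = 0) → m = 0

/-- The value on tangent vectors `s`, `t` at `x` of the cyclic 2-form `{e, f} = de df f⁻¹ e⁻¹`.
In the cyclic envelope the term with `de` evaluated on `t` and `df` on `s` is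
`- t(e) s(f) f⁻¹ e⁻¹ = - s(f) f⁻¹ e⁻¹ t(e)`. -/
def logForm (B : CyclicPairing R M N Q) (x : CubeEdge → Rˣ) (s : CubeEdge → M) (t : CubeEdge → N)
    (e f : CubeEdge) : Q :=
  B.pair (s e) (t f <• (((x f)⁻¹ * (x e)⁻¹ : Rˣ) : R)) -
    B.pair (s f <• (((x f)⁻¹ * (x e)⁻¹ : Rˣ) : R)) (t e)

/-- The value on tangent vectors `s`, `t` at `x` of the canonical 2-form: the sum over the
`∘`-vertices minus the sum over the `•`-vertices of the form `{e, f}` of the vertex `(e f g)`. -/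
def cubeForm (B : CyclicPairing R M N Q) (x : CubeEdge → Rˣ) (s : CubeEdge → M)
    (t : CubeEdge → N) : Q :=
  (logForm B x s t a4 a1 + logForm B x s t b2 b1 + logForm B x s t a2 a3 + logForm B x s t b4 b3) -
  (logForm B x s t b1 b4 + logForm B x s t a1 a2 + logForm B x s t b3 b2 + logForm B x s t a3 a4)

end Form

/-! Put `p = a4 b2` and `w = b1 b4 b3 b2`. Solving the vertex relations leaves `b1`, `b2`, `b4` free
and imposes only `p w = w p`, so the torus is parametrised by `cubePoint`. Up to conjugation, the
twelve equations run through the three forms of `p + w = 1` given by the order-three map `r ↦ (1 -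
r)⁻¹`. Hence the subvariety is the single condition `p + w = 1`
(`mem_cubeLagrangian_iff_add_eq_one`), which already forces `p` and `w` to commute.

For the 2-form, `{a, b}` is a group 2-cocycle, the cup product of logarithmic derivatives
(`derivForm_cocycle`). Any such cocycle, summed with signs over the vertices of the cube, collapses
to `{p, w} - {w, p}` (`cocycle_cube_sum_eq`). With `m = dp + dw` along `s`, `k = p⁻¹ w⁻¹`, and `t`
tangent to `p + w = 1`, this equals `-⟨k m + m k, δp⟩` (`cubeForm_eq`). If `s` is tangent too, then
`m = 0`: isotropy. Conversely `δp` is arbitrary, so nondegeneracy gives `k m + m k = 0`. Linearising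
`p w = w p` at `p + w = 1` shows that `m` commutes with `p` and hence with `k`, so `2 k m = 0` and
`m = 0`.

The symmetry group is simply transitive on the twelve edges and faithful on the four `∘`-vertices,
so it is the index-two subgroup of the symmetric group. -/

instance : Fintype CubeEdge where
  elems := {a1, a2, a3, a4, b1, b2, b3, b4, c1, c2, c3, c4}
  complete := by intro e; cases e <;> simp

theorem CubeEdge.card : Fintype.card CubeEdge = 12 := rfl

/-! ### The symmetry group of the cube -/

namespace CubeEdge

/-- The edge parallel to `e` and farthest from it. -/
def opp (e : CubeEdge) : CubeEdge := nextWhite (nextBlack (nextBlack (nextWhite e)))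

/-- The `∘`-vertex of an edge. -/
def white : CubeEdge → Fin 4
  | a4 => 0 | a1 => 0 | c1 => 0
  | b2 => 1 | b1 => 1 | c2 => 1
  | a2 => 2 | a3 => 2 | c3 => 2
  | b4 => 3 | b3 => 3 | c4 => 3

/-- An edge at a given `∘`-vertex. -/
def whiteRep : Fin 4 → CubeEdge
  | 0 => a1 | 1 => b1 | 2 => a2 | 3 => b3

/-- The only colour-preserving rotation of the cube that sends `a1` to `k`, evaluated at an edge. -/
def rot (k : CubeEdge) : CubeEdge → CubeEdge
  | a1 => k
  | c1 => nextWhite k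
  | a4 => nextWhite (nextWhite k)
  | a2 => nextBlack k
  | c2 => nextBlack (nextBlack k)
  | a3 => nextWhite (nextBlack k)
  | c3 => nextWhite (nextWhite (nextBlack k))
  | b2 => nextWhite (nextBlack (nextBlack k))
  | b1 => nextWhite (nextWhite (nextBlack (nextBlack k)))
  | b3 => nextWhite (nextBlack (nextBlack (nextWhite k)))
  | b4 => nextBlack (nextBlack (nextWhite k))
  | c4 => nextBlack (nextBlack (nextWhite (nextBlack k)))

theorem rot_nextWhite (k e : CubeEdge) : rot k (nextWhite e) = nextWhite (rot k e) := by
  cases k <;> cases e <;> rfl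

theorem rot_nextBlack (k e : CubeEdge) : rot k (nextBlack e) = nextBlack (rot k e) := by
  cases k <;> cases e <;> rfl

theorem rot_injective (k : CubeEdge) : Function.Injective (rot k) := by
  revert k; unfold Function.Injective; decide

theorem white_nextWhite (e : CubeEdge) : white (nextWhite e) = white e := by
  cases e <;> rfl

theorem eq_of_white_eq {e f : CubeEdge} (h : white e = white f) :
    f = e ∨ f = nextWhite e ∨ f = nextWhite (nextWhite e) := by
  revert e f; decide

theorem white_whiteRep (i : Fin 4) : white (whiteRep i) = i := by
  revert i; decide

theorem eq_a1_of_white_rot {k : CubeEdge} (h : ∀ i, white (rot k (whiteRep i)) = i) : k = a1 := by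
  revert k; decide

end CubeEdge

theorem cubeSymmetry_apply_nextWhite {g : Equiv.Perm CubeEdge} (hg : g ∈ cubeSymmetry)
    (e : CubeEdge) : g (nextWhite e) = nextWhite (g e) := (hg e).1

theorem cubeSymmetry_apply_nextBlack {g : Equiv.Perm CubeEdge} (hg : g ∈ cubeSymmetry)
    (e : CubeEdge) : g (nextBlack e) = nextBlack (g e) := (hg e).2

theorem cubeSymmetry_apply_opp {g : Equiv.Perm CubeEdge} (hg : g ∈ cubeSymmetry)
    (e : CubeEdge) : g (opp e) = opp (g e) := by
  simp only [opp, cubeSymmetry_apply_nextWhite hg, cubeSymmetry_apply_nextBlack hg]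

/-- Every edge is reached from `a1` by a word in `nextWhite` and `nextBlack`, and `rot` applies that
word to the image of `a1`. -/
theorem cubeSymmetry_apply_eq_rot {g : Equiv.Perm CubeEdge} (hg : g ∈ cubeSymmetry)
    (e : CubeEdge) : g e = rot (g a1) e := by
  cases e <;> simp only [rot, ← cubeSymmetry_apply_nextWhite hg, ← cubeSymmetry_apply_nextBlack hg]
    <;> rfl

/-- A colour-preserving rotation of the cube is determined by the image of one edge. -/
noncomputable def cubeSymmetryEquiv : cubeSymmetry ≃ CubeEdge :=
  Equiv.ofBijective (fun g => g.1 a1) <| by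
    constructor
    · intro g h hgh
      ext e
      rw [cubeSymmetry_apply_eq_rot g.2, cubeSymmetry_apply_eq_rot h.2]
      exact congrArg (rot · e) hgh
    · intro k
      exact ⟨⟨Equiv.ofBijective (rot k) (Finite.injective_iff_bijective.mp (rot_injective k)),
        fun e => ⟨rot_nextWhite k e, rot_nextBlack k e⟩⟩, rfl⟩

theorem white_apply_eq_of_white_eq {g : Equiv.Perm CubeEdge} (hg : g ∈ cubeSymmetry)
    {e f : CubeEdge} (h : white e = white f) : white (g e) = white (g f) := by
  rcases eq_of_white_eq h with rfl | rfl | rfl <;>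
    simp only [cubeSymmetry_apply_nextWhite hg, white_nextWhite]

/-- The action of the colour-preserving rotations on the four `∘`-vertices. -/
def cubeSymmetryWhite : cubeSymmetry →* Equiv.Perm (Fin 4) :=
  MonoidHom.toHomPerm
    { toFun := fun g i => white (g.1 (whiteRep i))
      map_one' := by funext i; exact white_whiteRep i
      map_mul' := by
        intro g h
        funext i
        -- The image vertex does not depend on the edge chosen to represent a `∘`-vertex.
        exact white_apply_eq_of_white_eq g.2 (white_whiteRep _).symm }

theorem cubeSymmetryWhite_apply (g : cubeSymmetry) (i : Fin 4) :
    cubeSymmetryWhite g i = white (g.1 (whiteRep i)) := rfl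

theorem cubeSymmetryWhite_injective : Function.Injective cubeSymmetryWhite := by
  rw [injective_iff_map_eq_one]
  intro g hg
  have h : g.1 a1 = a1 := eq_a1_of_white_rot fun i => by
    rw [← cubeSymmetry_apply_eq_rot g.2, ← cubeSymmetryWhite_apply, hg]; rfl
  exact cubeSymmetryEquiv.injective h

/-- By simple transitivity on edges the image has order 12, hence index 2 in a group of order 24,
and the alternating group is the only such subgroup. -/
theorem cubeSymmetryWhite_range : cubeSymmetryWhite.range = alternatingGroup (Fin 4) := by
  apply Equiv.Perm.eq_alternatingGroup_of_index_eq_two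
  have hc : Nat.card cubeSymmetryWhite.range = 12 := by
    rw [← Nat.card_congr (MonoidHom.ofInjective cubeSymmetryWhite_injective).toEquiv,
      Nat.card_congr cubeSymmetryEquiv, Nat.card_eq_fintype_card, CubeEdge.card]
  have h := cubeSymmetryWhite.range.card_mul_index
  rw [hc, Nat.card_perm, Nat.card_eq_fintype_card, Fintype.card_fin] at h
  simp only [Nat.factorial] at h
  omega

theorem nonempty_cubeSymmetry_mulEquiv : Nonempty (cubeSymmetry ≃* alternatingGroup (Fin 4)) :=
  ⟨(MonoidHom.ofInjective cubeSymmetryWhite_injective).trans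
    (MulEquiv.subgroupCongr cubeSymmetryWhite_range)⟩

/-! ### Points of the torus and of the subvariety -/

section Points

variable {R : Type u} [Ring R]

theorem mul_mul_eq_iff_cyclic {a b c z : Rˣ} (hz : ∀ u, z * u = u * z) :
    a * b * c = z ↔ b * c * a = z := by
  constructor <;> intro h
  · rw [← mul_right_inj a, ← hz, ← h]; simp only [mul_assoc]
  · rw [← mul_left_inj a, hz, ← h]; simp only [mul_assoc]

/-- Eliminates an edge `c` shared by a `∘`-vertex and a `•`-vertex; the four edges `c1`, …, `c4`
give the relations used for the 2-form. -/
theorem mul_eq_neg_one_mul_mul {a b c a' b' : Rˣ} (h : a * b * c = -1) (h' : a' * b' * c = 1) :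
    a * b = -1 * (a' * b') := by
  rw [← mul_left_inj c, h, mul_assoc, h', mul_one]

theorem mem_cubeTorus_iff {x : CubeEdge → Rˣ} : x ∈ cubeTorus R ↔
    (∀ e, x e * x (nextWhite e) * x (nextWhite (nextWhite e)) = -1) ∧
    (∀ e, x e * x (nextBlack e) * x (nextBlack (nextBlack e)) = 1) := by
  have hneg : ∀ u : Rˣ, -1 * u = u * -1 := by simp
  have hone : ∀ u : Rˣ, 1 * u = u * 1 := by simp
  constructor
  · rintro ⟨h1, h2, h3, h4, h5, h6, h7, h8⟩
    have h1' := (mul_mul_eq_iff_cyclic hneg).mp h1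
    have h2' := (mul_mul_eq_iff_cyclic hneg).mp h2
    have h3' := (mul_mul_eq_iff_cyclic hneg).mp h3
    have h4' := (mul_mul_eq_iff_cyclic hneg).mp h4
    have h5' := (mul_mul_eq_iff_cyclic hone).mp h5
    have h6' := (mul_mul_eq_iff_cyclic hone).mp h6
    have h7' := (mul_mul_eq_iff_cyclic hone).mp h7
    have h8' := (mul_mul_eq_iff_cyclic hone).mp h8
    constructor
    · intro e
      cases e <;> first | assumption | (apply (mul_mul_eq_iff_cyclic hneg).mp; assumption)
    · intro e
      cases e <;> first | assumption | (apply (mul_mul_eq_iff_cyclic hone).mp; assumption)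
  · rintro ⟨hw, hb⟩
    exact ⟨hw a4, hw b2, hw a2, hw b4, hb b1, hb a1, hb b3, hb a3⟩

/-- Indexing the equations by edges through `opp` and `nextBlack`, which commute with every
symmetry, makes invariance immediate. -/
theorem mem_cubeLagrangian_iff {x : CubeEdge → Rˣ} : x ∈ cubeLagrangian R ↔
    x ∈ cubeTorus R ∧
      ∀ e, edgeSum x e (opp e) (nextBlack (opp e)) (opp (nextBlack (opp e))) = 1 := by
  constructor
  · rintro ⟨hx, ⟨h1, h2, h3, h4⟩, ⟨h5, h6, h7, h8⟩, h9, h10, h11, h12⟩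
    exact ⟨hx, fun e => by cases e <;> assumption⟩
  · rintro ⟨hx, h⟩
    exact ⟨hx, ⟨h a4, h b2, h a2, h b4⟩, ⟨h a1, h b3, h a3, h b1⟩, h c1, h c3, h c2, h c4⟩

theorem comp_mem_cubeTorus {g : Equiv.Perm CubeEdge} (hg : g ∈ cubeSymmetry) {x : CubeEdge → Rˣ}
    (hx : x ∈ cubeTorus R) : (fun e => x (g e)) ∈ cubeTorus R := by
  rw [mem_cubeTorus_iff] at hx ⊢
  simp only [cubeSymmetry_apply_nextWhite hg, cubeSymmetry_apply_nextBlack hg]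
  exact ⟨fun e => hx.1 (g e), fun e => hx.2 (g e)⟩

theorem comp_mem_cubeLagrangian {g : Equiv.Perm CubeEdge} (hg : g ∈ cubeSymmetry)
    {x : CubeEdge → Rˣ} (hx : x ∈ cubeLagrangian R) :
    (fun e => x (g e)) ∈ cubeLagrangian R := by
  rw [mem_cubeLagrangian_iff] at hx ⊢
  refine ⟨comp_mem_cubeTorus hg hx.1, fun e => ?_⟩
  have h := hx.2 (g e)
  simpa only [edgeSum, cubeSymmetry_apply_opp hg, cubeSymmetry_apply_nextBlack hg] using h

theorem mem_of_comp_mem {X : Set (CubeEdge → Rˣ)}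
    (hX : ∀ g ∈ cubeSymmetry, ∀ x ∈ X, (fun e => x (g e)) ∈ X) {g : Equiv.Perm CubeEdge}
    (hg : g ∈ cubeSymmetry) {x : CubeEdge → Rˣ} : x ∈ X ↔ (fun e => x (g e)) ∈ X := by
  refine ⟨hX g hg x, fun h => ?_⟩
  simpa using hX g⁻¹ (inv_mem hg) _ h

/-- The point of the torus with `a4 b2 = p`, `b1 b4 b3 b2 = w` and given `b1`, `b2`, `b4`. -/
def cubePoint (p w y1 y2 y4 : Rˣ) : CubeEdge → Rˣ
  | a1 => -(y2 * p⁻¹ * y1 * y4)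
  | a2 => y4⁻¹ * y1⁻¹ * p * y1
  | a3 => -(y1⁻¹ * p⁻¹ * w)
  | a4 => p * y2⁻¹
  | b1 => y1
  | b2 => y2
  | b3 => y4⁻¹ * y1⁻¹ * w * y2⁻¹
  | b4 => y4
  | c1 => y4⁻¹ * y1⁻¹
  | c2 => -(y1⁻¹ * y2⁻¹)
  | c3 => w⁻¹ * y1 * y4
  | c4 => -(y2 * w⁻¹ * y1)

theorem cubePoint_mem_cubeTorus {p w : Rˣ} (h : w * p = p * w) (y1 y2 y4 : Rˣ) :
    cubePoint p w y1 y2 y4 ∈ cubeTorus R := by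
  -- Only the relation at `(a3 a4 c4)` needs `p` and `w` to commute.
  have h' : w * (p * (w⁻¹ * y1)) = p * y1 := by
    rw [← mul_assoc, h]; simp [mul_assoc]
  simp [cubeTorus, cubePoint, mul_assoc, h']

theorem eq_cubePoint_of_mem_cubeTorus {x : CubeEdge → Rˣ} (hx : x ∈ cubeTorus R) :
    (x b1 * x b4 * x b3 * x b2) * (x a4 * x b2) = (x a4 * x b2) * (x b1 * x b4 * x b3 * x b2) ∧
    x = cubePoint (x a4 * x b2) (x b1 * x b4 * x b3 * x b2) (x b1) (x b2) (x b4) := by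
  obtain ⟨h1, h2, h3, h4, h5, h6, h7, h8⟩ := hx
  have e1 : x c1 = (x b4)⁻¹ * (x b1)⁻¹ := by
    rw [← mul_inv_rev]; exact eq_inv_of_mul_eq_one_right h5
  have e2 : x c2 = -((x b1)⁻¹ * (x b2)⁻¹) := by
    rw [← mul_inv_rev, ← mul_right_inj (x b2 * x b1), h2]; simp
  have e3 : x c3 = (x b2)⁻¹ * (x b3)⁻¹ := by
    rw [← mul_inv_rev]; exact eq_inv_of_mul_eq_one_right h7
  have e4 : x c4 = -((x b3)⁻¹ * (x b4)⁻¹) := by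
    rw [← mul_inv_rev, ← mul_right_inj (x b4 * x b3), h4]; simp
  have f1 : x a1 = -((x a4)⁻¹ * x b1 * x b4) := by
    rw [e1, ← mul_assoc, mul_inv_eq_iff_eq_mul, mul_inv_eq_iff_eq_mul] at h1
    rw [← mul_right_inj (x a4), h1]; simp [mul_assoc]
  have f2 : x a2 = (x b4)⁻¹ * (x b1)⁻¹ * x a4 * x b2 * x b1 := by
    rw [e2, f1] at h6
    rw [← mul_right_inj (-((x a4)⁻¹ * x b1 * x b4)), ← mul_left_inj (-((x b1)⁻¹ * (x b2)⁻¹)), h6]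
    simp [mul_assoc]
  have f3 : x a3 = -(x b4 * x b3 * (x a4)⁻¹) := by
    rw [e4] at h8
    rw [← mul_left_inj (x a4), ← mul_left_inj (-((x b3)⁻¹ * (x b4)⁻¹)), h8]
    simp [mul_assoc]
  -- Seven relations have been used to solve for `c1`, …, `c4`, `a1`, `a2`, `a3`; the remaining one,
  -- at `(a2 a3 c3)`, is the commutation of `p` and `w`.
  have key : x a4 * x b2 * x b1 * x b4 * x b3 = x b1 * x b4 * x b3 * x b2 * x a4 := by
    rw [e3, f2, f3] at h3
    have h3' := congrArg (fun u => x b1 * x b4 * u * x b3 * x b2 * x a4) h3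
    simp only [mul_neg, neg_mul, mul_assoc, neg_inj, mul_inv_cancel_left, inv_mul_cancel,
      mul_one] at h3' ⊢
    exact h3'
  have comm : (x b1 * x b4 * x b3 * x b2) * (x a4 * x b2) =
      (x a4 * x b2) * (x b1 * x b4 * x b3 * x b2) := by
    have := congrArg (· * x b2) key
    simp only [mul_assoc] at this ⊢
    exact this.symm
  refine ⟨comm, ?_⟩
  funext e
  cases e
  case a3 =>
    simp only [cubePoint]
    rw [f3, neg_inj, ← mul_left_inj (x a4), ← mul_right_inj (x a4 * x b2 * x b1)]
    simp only [mul_assoc, mul_inv_cancel_left, inv_mul_cancel, mul_inv_rev, mul_one] at key ⊢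
    exact key
  all_goals simp [cubePoint, *, mul_assoc]

theorem edgeSum_eq_one_of_conj {x : CubeEdge → Rˣ} {e f g h : CubeEdge} {a b : Rˣ} (u : Rˣ)
    (hab : (a : R) + ((b⁻¹ : Rˣ) : R) = 1) (h1 : x e * x f = u * a * u⁻¹)
    (h2 : x g * x h = u * b * u⁻¹) : edgeSum x e f g h = 1 := by
  rw [edgeSum, ← Units.val_mul, h1, h2]
  have : (u : R) * ((a : R) + ((b⁻¹ : Rˣ) : R)) * ((u⁻¹ : Rˣ) : R) = 1 := by rw [hab]; simp
  rw [← this]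
  simp [mul_add, add_mul, mul_assoc]

theorem cubePoint_mem_cubeLagrangian {p w : Rˣ} (h : (p : R) + w = 1) (y1 y2 y4 : Rˣ) :
    cubePoint p w y1 y2 y4 ∈ cubeLagrangian R := by
  have hw : (w : R) = 1 - p := by rw [← h]; abel
  have comm : w * p = p * w := by
    ext; simp [hw, sub_mul, mul_sub]
  have hcw' : ∀ u, w * (p⁻¹ * u) = p⁻¹ * (w * u) := fun u => by
    rw [← mul_assoc, ← mul_assoc, (Commute.inv_right comm : w * p⁻¹ = p⁻¹ * w)]
  -- The relation `a + b⁻¹ = 1` says `b = (1 - a)⁻¹`. Iterating from `p` gives the 3-cycle `p`,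
  -- `w⁻¹`, `-(p⁻¹ w)`, and each equation is a conjugate of one of its three steps.
  have k1 : (p : R) + ((w⁻¹⁻¹ : Rˣ) : R) = 1 := by simpa using h
  have k2 : ((w⁻¹ : Rˣ) : R) + (((-(p⁻¹ * w))⁻¹ : Rˣ) : R) = 1 := by
    rw [← Units.mul_right_inj w]
    simp only [mul_add, inv_neg, mul_inv_rev, inv_inv, Units.val_neg, Units.val_mul, mul_neg,
      Units.mul_inv, Units.mul_inv_cancel_left, mul_one]
    rw [hw]
    abel
  have k3 : ((-(p⁻¹ * w) : Rˣ) : R) + ((p⁻¹ : Rˣ) : R) = 1 := by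
    rw [← Units.mul_right_inj p]
    simp [mul_add, hw]
  refine ⟨cubePoint_mem_cubeTorus comm .., ⟨?_, ?_, ?_, ?_⟩, ⟨?_, ?_, ?_, ?_⟩, ?_, ?_, ?_, ?_⟩
  · exact edgeSum_eq_one_of_conj 1 k1 (by simp [cubePoint]) (by simp [cubePoint, mul_assoc])
  · exact edgeSum_eq_one_of_conj y2 k1 (by simp [cubePoint, mul_assoc])
      (by simp [cubePoint, mul_assoc])
  · exact edgeSum_eq_one_of_conj (y4⁻¹ * y1⁻¹) k1 (by simp [cubePoint, mul_assoc])
      (by simp [cubePoint, mul_assoc])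
  · exact edgeSum_eq_one_of_conj y1⁻¹ k1 (by simp [cubePoint, mul_assoc])
      (by simp [cubePoint, mul_assoc])
  · exact edgeSum_eq_one_of_conj y2 k3 (by simp [cubePoint, mul_assoc])
      (by simp [cubePoint, mul_assoc])
  · exact edgeSum_eq_one_of_conj (y4⁻¹ * y1⁻¹) k3 (by simp [cubePoint, mul_assoc, hcw'])
      (by simp [cubePoint, mul_assoc])
  · exact edgeSum_eq_one_of_conj y1⁻¹ k3 (by simp [cubePoint, mul_assoc])
      (by simp [cubePoint, mul_assoc])
  · exact edgeSum_eq_one_of_conj 1 k3 (by simp [cubePoint, mul_assoc])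
      (by simp [cubePoint, mul_assoc])
  · exact edgeSum_eq_one_of_conj (y4⁻¹ * y1⁻¹) k2 (by simp [cubePoint, mul_assoc])
      (by simp [cubePoint, mul_assoc, hcw'])
  · exact edgeSum_eq_one_of_conj 1 k2 (by simp [cubePoint, mul_assoc])
      (by simp [cubePoint, mul_assoc])
  · exact edgeSum_eq_one_of_conj y1⁻¹ k2 (by simp [cubePoint, mul_assoc])
      (by simp [cubePoint, mul_assoc])
  · exact edgeSum_eq_one_of_conj y2 k2 (by simp [cubePoint, mul_assoc])
      (by simp [cubePoint, mul_assoc])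

/-- On the torus the twelve equations are equivalent to a single one. -/
theorem mem_cubeLagrangian_iff_add_eq_one {x : CubeEdge → Rˣ} : x ∈ cubeLagrangian R ↔
    x ∈ cubeTorus R ∧
      ((x a4 * x b2 : Rˣ) : R) + ((x b1 * x b4 * x b3 * x b2 : Rˣ) : R) = 1 := by
  constructor
  · rintro ⟨hx, ⟨h, -⟩, -⟩
    refine ⟨hx, ?_⟩
    obtain ⟨-, -, -, -, h5, -, h7, -⟩ := hx
    -- The first of the twelve equations is already `p + w = 1`, since `c1⁻¹ = b1 b4` and `c3⁻¹ = b3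
    -- b2`.
    rw [← h, edgeSum, mul_inv_rev, ← eq_inv_of_mul_eq_one_left h5,
      ← eq_inv_of_mul_eq_one_left h7]
    simp [mul_assoc]
  · rintro ⟨hx, h⟩
    rw [(eq_cubePoint_of_mem_cubeTorus hx).2]
    exact cubePoint_mem_cubeLagrangian h _ _ _

theorem cubeLagrangian_nonempty_iff :
    (cubeLagrangian R).Nonempty ↔ ∃ r : Rˣ, IsUnit (1 - (r : R)) := by
  constructor
  · rintro ⟨x, hx⟩
    refine ⟨x a4 * x b2, x b1 * x b4 * x b3 * x b2, ?_⟩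
    rw [← (mem_cubeLagrangian_iff_add_eq_one.mp hx).2]
    abel
  · rintro ⟨r, w, hw⟩
    exact ⟨_, cubePoint_mem_cubeLagrangian (p := r) (w := w) (by rw [hw]; abel) 1 1 1⟩

theorem Units.map_cubePoint {S : Type v} [Ring S] (φ : R →+* S) (p w y1 y2 y4 : Rˣ)
    (e : CubeEdge) : Units.map (φ : R →* S) (cubePoint p w y1 y2 y4 e) =
      cubePoint (Units.map (φ : R →* S) p) (Units.map (φ : R →* S) w)
        (Units.map (φ : R →* S) y1) (Units.map (φ : R →* S) y2) (Units.map (φ : R →* S) y4) e := by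
  have hneg : ∀ u : Rˣ, Units.map (φ : R →* S) (-u) = -Units.map (φ : R →* S) u := fun u => by
    ext; simp
  cases e <;> simp only [cubePoint, map_mul, map_inv, hneg]

end Points

/-! ### A cocycle identity on the cube -/

section Cocycle

variable {G : Type*} [Group G] {Q : Type*} [AddCommGroup Q]

/-- For a 2-cocycle `F` that does not see the central element `z`, the sum of `F` over the
`∘`-vertices minus the sum over the `•`-vertices is the commutator pairing of `a4 b2` and
`b1 b4 b3 b2`. -/
theorem cocycle_cube_sum_eq (F : G → G → Q)
    (hF : ∀ a b c, F a b + F (a * b) c = F b c + F a (b * c)) {z : G}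
    (hl : ∀ a b, F (z * a) b = F a b) (hr : ∀ a b, F a (z * b) = F a b)
    (hz : ∀ a, a * z = z * a) {a1 a2 a3 a4 b1 b2 b3 b4 : G}
    (h1 : a4 * a1 = z * (b1 * b4)) (h2 : b2 * b1 = z * (a1 * a2))
    (h3 : a2 * a3 = z * (b3 * b2)) (h4 : b4 * b3 = z * (a3 * a4)) :
    (F a4 a1 + F b2 b1 + F a2 a3 + F b4 b3) - (F b1 b4 + F a1 a2 + F b3 b2 + F a3 a4) =
      F (a4 * b2) (b1 * b4 * b3 * b2) - F (b1 * b4 * b3 * b2) (a4 * b2) := by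
  have hz' : ∀ a b, a * (z * b) = z * (a * b) := fun a b => by rw [← mul_assoc, hz, mul_assoc]
  have h1' : ∀ u, a4 * (a1 * u) = z * (b1 * (b4 * u)) := fun u => by
    rw [← mul_assoc, h1]; simp only [mul_assoc]
  have h2' : ∀ u, b2 * (b1 * u) = z * (a1 * (a2 * u)) := fun u => by
    rw [← mul_assoc, h2]; simp only [mul_assoc]
  have h3' : ∀ u, a2 * (a3 * u) = z * (b3 * (b2 * u)) := fun u => by
    rw [← mul_assoc, h3]; simp only [mul_assoc]
  have h4' : ∀ u, b4 * (b3 * u) = z * (a3 * (a4 * u)) := fun u => by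
    rw [← mul_assoc, h4]; simp only [mul_assoc]
  -- Each of the eight vertex terms occurs in one of `e2`–`e8`, `e11`; `e1` and `e9` bring in the
  -- two terms of the commutator pairing, and `e10` links the leftovers. After reduction modulo `z`
  -- all other terms cancel.
  have e1 := hF a4 b2 (b1 * (b4 * (b3 * b2)))
  have e2 := hF b2 b1 (b4 * (b3 * b2))
  have e3 := hF a1 a2 (b4 * (b3 * b2))
  have e4 := hF a4 a1 (a2 * (b4 * (b3 * b2)))
  have e5 := hF b1 b4 (a2 * (b4 * (b3 * b2)))
  have e6 := hF a2 a3 (a4 * b2)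
  have e7 := hF b3 b2 (a4 * b2)
  have e8 := hF b4 b3 (b2 * (a4 * b2))
  have e9 := hF b1 (b4 * (b3 * b2)) (a4 * b2)
  have e10 := hF (b4 * b3) b2 (a4 * b2)
  have e11 := hF a3 a4 b2
  simp only [mul_assoc, h1, h2, h3, h4, h1', h2', h3', h4', hz', hl, hr] at *
  grind

end Cocycle

/-! ### The 2-form as a group cocycle -/

section Form

variable {R : Type u} [Ring R] {M : Type v} {N : Type w} {Q : Type z}
  [AddCommGroup M] [Module R M] [Module Rᵐᵒᵖ M]
  [AddCommGroup N] [Module R N] [Module Rᵐᵒᵖ N] [AddCommGroup Q]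

/-- The left logarithmic derivative `a⁻¹ da`. -/
def leftLog {G : Type*} [Group G] (ρ : G →* Rˣ) (d : G → M) (a : G) : M :=
  (((ρ a)⁻¹ : Rˣ) : R) • d a

/-- The right logarithmic derivative `da a⁻¹`. -/
def rightLog {G : Type*} [Group G] (ρ : G →* Rˣ) (d : G → M) (a : G) : M :=
  d a <• (((ρ a)⁻¹ : Rˣ) : R)

/-- The form `{a, b} = da db b⁻¹ a⁻¹` evaluated on a pair of derivations `d`, `δ` along `ρ`. -/
def derivForm (B : CyclicPairing R M N Q) {G : Type*} [Group G] (ρ : G →* Rˣ) (d : G → M)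
    (δ : G → N) (a b : G) : Q :=
  B.pair (d a) (δ b <• (((ρ b)⁻¹ * (ρ a)⁻¹ : Rˣ) : R)) -
    B.pair (d b <• (((ρ b)⁻¹ * (ρ a)⁻¹ : Rˣ) : R)) (δ a)

variable (B : CyclicPairing R M N Q) {G : Type*} [Group G] {ρ : G →* Rˣ} {d : G → M} {δ : G → N}

theorem derivForm_eq (a b : G) : derivForm B ρ d δ a b =
    B.pair (leftLog ρ d a) (rightLog ρ δ b) - B.pair (rightLog ρ d b) (leftLog ρ δ a) := by
  simp only [derivForm, leftLog, rightLog, B.pair_left_smul, ← B.pair_right_smul, smul_smul,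
    ← MulOpposite.op_mul, Units.val_mul]

theorem leftLog_mul [SMulCommClass R Rᵐᵒᵖ M]
    (hd : ∀ a b, d (a * b) = (ρ a : R) • d b + d a <• (ρ b : R)) (a b : G) :
    leftLog ρ d (a * b) =
      leftLog ρ d b + (((ρ b)⁻¹ : Rˣ) : R) • leftLog ρ d a <• (ρ b : R) := by
  simp only [leftLog, hd, smul_add, map_mul, mul_inv_rev, Units.val_mul, mul_smul,
    smul_comm _ (MulOpposite.op _)]
  rw [smul_smul _ (ρ a : R), Units.inv_mul, one_smul]

theorem rightLog_mul [SMulCommClass R Rᵐᵒᵖ M]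
    (hd : ∀ a b, d (a * b) = (ρ a : R) • d b + d a <• (ρ b : R)) (a b : G) :
    rightLog ρ d (a * b) =
      rightLog ρ d a + (ρ a : R) • rightLog ρ d b <• (((ρ a)⁻¹ : Rˣ) : R) := by
  simp only [rightLog, hd, smul_add, map_mul, mul_inv_rev, Units.val_mul, MulOpposite.op_mul,
    mul_smul, smul_comm _ (MulOpposite.op _)]
  rw [smul_smul _ (MulOpposite.op (ρ b : R)), ← MulOpposite.op_mul, Units.mul_inv,
    MulOpposite.op_one, one_smul, add_comm]

/-- Both logarithmic derivatives are crossed homomorphisms for conjugation. Cyclic invariance moves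
the conjugation by `b` from one argument of the pairing to the other, which matches the mixed terms.
-/
theorem derivForm_cocycle [SMulCommClass R Rᵐᵒᵖ M] [SMulCommClass R Rᵐᵒᵖ N]
    (hd : ∀ a b, d (a * b) = (ρ a : R) • d b + d a <• (ρ b : R))
    (hδ : ∀ a b, δ (a * b) = (ρ a : R) • δ b + δ a <• (ρ b : R)) (a b c : G) :
    derivForm B ρ d δ a b + derivForm B ρ d δ (a * b) c =
      derivForm B ρ d δ b c + derivForm B ρ d δ a (b * c) := by
  simp only [derivForm_eq, leftLog_mul hd, leftLog_mul hδ, rightLog_mul hd, rightLog_mul hδ,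
    map_add, AddMonoidHom.add_apply, B.pair_left_smul, B.pair_right_smul,
    smul_comm _ (MulOpposite.op _)]
  abel

theorem leftLog_mul_of_eq_zero [SMulCommClass R Rᵐᵒᵖ M]
    (hd : ∀ a b, d (a * b) = (ρ a : R) • d b + d a <• (ρ b : R)) {z : G}
    (hdz : d z = 0) (a : G) : leftLog ρ d (z * a) = leftLog ρ d a := by
  rw [leftLog_mul hd]
  simp [leftLog, hdz]

theorem rightLog_mul_of_map_eq_neg_one [SMulCommClass R Rᵐᵒᵖ M]
    (hd : ∀ a b, d (a * b) = (ρ a : R) • d b + d a <• (ρ b : R)) {z : G} (hz : ρ z = -1)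
    (hdz : d z = 0) (a : G) : rightLog ρ d (z * a) = rightLog ρ d a := by
  rw [rightLog_mul hd]
  simp [rightLog, hdz, hz, MulOpposite.op_neg, inv_neg]

/-- On a point of the torus the canonical form is the commutator pairing of `a4 b2` and
`b1 b4 b3 b2`. -/
theorem derivForm_cube_sum_eq [SMulCommClass R Rᵐᵒᵖ M] [SMulCommClass R Rᵐᵒᵖ N]
    (hd : ∀ a b, d (a * b) = (ρ a : R) • d b + d a <• (ρ b : R))
    (hδ : ∀ a b, δ (a * b) = (ρ a : R) • δ b + δ a <• (ρ b : R)) {z : G} (hρz : ρ z = -1)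
    (hdz : d z = 0) (hδz : δ z = 0) (hz : ∀ a, a * z = z * a) {a1 a2 a3 a4 b1 b2 b3 b4 : G}
    (h1 : a4 * a1 = z * (b1 * b4)) (h2 : b2 * b1 = z * (a1 * a2))
    (h3 : a2 * a3 = z * (b3 * b2)) (h4 : b4 * b3 = z * (a3 * a4)) :
    (derivForm B ρ d δ a4 a1 + derivForm B ρ d δ b2 b1 + derivForm B ρ d δ a2 a3 +
        derivForm B ρ d δ b4 b3) -
      (derivForm B ρ d δ b1 b4 + derivForm B ρ d δ a1 a2 + derivForm B ρ d δ b3 b2 +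
        derivForm B ρ d δ a3 a4) =
      derivForm B ρ d δ (a4 * b2) (b1 * b4 * b3 * b2) -
        derivForm B ρ d δ (b1 * b4 * b3 * b2) (a4 * b2) := by
  refine cocycle_cube_sum_eq _ (derivForm_cocycle B hd hδ) (z := z) ?_ ?_ hz h1 h2 h3 h4
  · intro a b
    simp only [derivForm_eq, leftLog_mul_of_eq_zero hd hdz,
      leftLog_mul_of_eq_zero hδ hδz]
  · intro a b
    simp only [derivForm_eq, rightLog_mul_of_map_eq_neg_one hd hρz hdz,
      rightLog_mul_of_map_eq_neg_one hδ hρz hδz]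

/-- The commutator pairing on a vector `δ` tangent to `p + w = const`. -/
theorem derivForm_sub_swap_eq {p w : G} (hpw : w * p = p * w) (hδ : δ w = -δ p) :
    derivForm B ρ d δ p w - derivForm B ρ d δ w p =
      -B.pair ((((ρ p)⁻¹ * (ρ w)⁻¹ : Rˣ) : R) • (d p + d w) +
        (d p + d w) <• (((ρ p)⁻¹ * (ρ w)⁻¹ : Rˣ) : R)) (δ p) := by
  have hk : (ρ w)⁻¹ * (ρ p)⁻¹ = (ρ p)⁻¹ * (ρ w)⁻¹ := by
    rw [← mul_inv_rev, ← mul_inv_rev, ← map_mul, ← map_mul, hpw]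
  simp only [derivForm, hk, hδ, smul_neg, map_neg, smul_add, map_add, AddMonoidHom.add_apply,
    B.pair_left_smul]
  abel

end Form

/-! ### Tangent vectors, isotropy and maximality -/

section Tangent

variable {R : Type u} [Ring R] {M : Type v} {N : Type w} {Q : Type z}
  [AddCommGroup M] [Module R M] [Module Rᵐᵒᵖ M] [SMulCommClass R Rᵐᵒᵖ M]
  [AddCommGroup N] [Module R N] [Module Rᵐᵒᵖ N] [SMulCommClass R Rᵐᵒᵖ N] [AddCommGroup Q]

variable (R M) in
/-- The projection of the units of a square-zero extension to the units of the base. -/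
def unitsFst : (TrivSqZeroExt R M)ˣ →* Rˣ :=
  Units.map
    { toFun := TrivSqZeroExt.fst
      map_one' := TrivSqZeroExt.fst_one
      map_mul' := TrivSqZeroExt.fst_mul : TrivSqZeroExt R M →* R }

theorem val_unitsFst (y : (TrivSqZeroExt R M)ˣ) :
    (unitsFst R M y : R) = (y : TrivSqZeroExt R M).fst := rfl

theorem unitsFst_cubePoint (p w y1 y2 y4 : (TrivSqZeroExt R M)ˣ) (e : CubeEdge) :
    unitsFst R M (cubePoint p w y1 y2 y4 e) =
      cubePoint (unitsFst R M p) (unitsFst R M w) (unitsFst R M y1) (unitsFst R M y2)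
        (unitsFst R M y4) e :=
  Units.map_cubePoint
    { toFun := TrivSqZeroExt.fst
      map_one' := TrivSqZeroExt.fst_one
      map_mul' := TrivSqZeroExt.fst_mul
      map_zero' := TrivSqZeroExt.fst_zero
      map_add' := TrivSqZeroExt.fst_add } p w y1 y2 y4 e

theorem mem_tangentVectors_iff {X : Set (CubeEdge → (TrivSqZeroExt R M)ˣ)} {x : CubeEdge → Rˣ}
    {s : CubeEdge → M} : s ∈ tangentVectors X x ↔
      ∃ y ∈ X, (∀ e, unitsFst R M (y e) = x e) ∧
        ∀ e, (y e : TrivSqZeroExt R M).snd = s e := by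
  refine exists_congr fun y => and_congr_right fun _ => ?_
  rw [← forall_and]
  refine forall_congr' fun e => ?_
  rw [TrivSqZeroExt.ext_iff, Units.ext_iff, val_unitsFst]
  simp

variable (R M N) in
/-- The pairs of units of two square-zero extensions over a common unit of the base. -/
abbrev UnitsPair : Subgroup ((TrivSqZeroExt R M)ˣ × (TrivSqZeroExt R N)ˣ) :=
  MonoidHom.eqLocus ((unitsFst R M).comp (MonoidHom.fst _ _))
    ((unitsFst R N).comp (MonoidHom.snd _ _))

/-- The canonical form at a pair of tangent vectors to the torus depends only on the values of
`a4 b2` and `b1 b4 b3 b2`. -/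
theorem cubeForm_eq (B : CyclicPairing R M N Q) {x : CubeEdge → Rˣ}
    {y : CubeEdge → (TrivSqZeroExt R M)ˣ} (hy : y ∈ cubeTorus (TrivSqZeroExt R M))
    (hyx : ∀ e, unitsFst R M (y e) = x e)
    {y' : CubeEdge → (TrivSqZeroExt R N)ˣ} (hy' : y' ∈ cubeTorus (TrivSqZeroExt R N))
    (hyx' : ∀ e, unitsFst R N (y' e) = x e)
    (h : ((y' a4 * y' b2 : (TrivSqZeroExt R N)ˣ) : TrivSqZeroExt R N) +
      ((y' b1 * y' b4 * y' b3 * y' b2 : (TrivSqZeroExt R N)ˣ) : TrivSqZeroExt R N) = 1) :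
    cubeForm B x (fun e => (y e : TrivSqZeroExt R M).snd)
        (fun e => (y' e : TrivSqZeroExt R N).snd) =
      -B.pair (((((x a4 * x b2)⁻¹ * (x b1 * x b4 * x b3 * x b2)⁻¹ : Rˣ) : R) •
          (((y a4 * y b2 : (TrivSqZeroExt R M)ˣ) : TrivSqZeroExt R M) +
          ((y b1 * y b4 * y b3 * y b2 : (TrivSqZeroExt R M)ˣ) : TrivSqZeroExt R M)).snd) +
          (((y a4 * y b2 : (TrivSqZeroExt R M)ˣ) : TrivSqZeroExt R M) +
          ((y b1 * y b4 * y b3 * y b2 : (TrivSqZeroExt R M)ˣ) : TrivSqZeroExt R M)).snd <•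
          (((x a4 * x b2)⁻¹ * (x b1 * x b4 * x b3 * x b2)⁻¹ : Rˣ) : R))
        ((y' a4 * y' b2 : (TrivSqZeroExt R N)ˣ) : TrivSqZeroExt R N).snd := by
  -- The lifts for `s` and `t` lie in different extensions; the fibre product is one group carrying
  -- both ε-components as derivations along the same `ρ`.
  let ρ : UnitsPair R M N →* Rˣ :=
    ((unitsFst R M).comp (MonoidHom.fst _ _)).comp (UnitsPair R M N).subtype
  let d : UnitsPair R M N → M := fun a => (a.1.1 : TrivSqZeroExt R M).snd
  let δ : UnitsPair R M N → N := fun a => (a.1.2 : TrivSqZeroExt R N).snd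
  have hρ' : ∀ a : UnitsPair R M N, (a.1.2 : TrivSqZeroExt R N).fst = (ρ a : R) :=
    fun a => congrArg Units.val a.2.symm
  have hd : ∀ a b, d (a * b) = (ρ a : R) • d b + d a <• (ρ b : R) := fun a b =>
    TrivSqZeroExt.snd_mul _ _
  have hδ : ∀ a b, δ (a * b) = (ρ a : R) • δ b + δ a <• (ρ b : R) := fun a b => by
    rw [← hρ', ← hρ']
    exact TrivSqZeroExt.snd_mul _ _
  let Y : CubeEdge → UnitsPair R M N := fun e => ⟨(y e, y' e), (hyx e).trans (hyx' e).symm⟩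
  have hρY : ∀ e, ρ (Y e) = x e := hyx
  let ζ : UnitsPair R M N := ⟨(-1, -1), by ext; simp [val_unitsFst]⟩
  have comm := (eq_cubePoint_of_mem_cubeTorus hy).1
  have comm' := (eq_cubePoint_of_mem_cubeTorus hy').1
  obtain ⟨h1, h2, h3, h4, h5, h6, h7, h8⟩ := hy
  obtain ⟨k1, k2, k3, k4, k5, k6, k7, k8⟩ := hy'
  have key := derivForm_cube_sum_eq B (d := d) (δ := δ) hd hδ (z := ζ)
    (by ext; simp [ρ, ζ, val_unitsFst]) (by simp [d, ζ]) (by simp [δ, ζ])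
    (fun a => Subtype.ext (Prod.ext (by simp [ζ]) (by simp [ζ])))
    (a1 := Y a1) (a2 := Y a2) (a3 := Y a3) (a4 := Y a4)
    (b1 := Y b1) (b2 := Y b2) (b3 := Y b3) (b4 := Y b4)
    (Subtype.ext (Prod.ext (mul_eq_neg_one_mul_mul h1 h5) (mul_eq_neg_one_mul_mul k1 k5)))
    (Subtype.ext (Prod.ext (mul_eq_neg_one_mul_mul h2 h6) (mul_eq_neg_one_mul_mul k2 k6)))
    (Subtype.ext (Prod.ext (mul_eq_neg_one_mul_mul h3 h7) (mul_eq_neg_one_mul_mul k3 k7)))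
    (Subtype.ext (Prod.ext (mul_eq_neg_one_mul_mul h4 h8) (mul_eq_neg_one_mul_mul k4 k8)))
  rw [derivForm_sub_swap_eq B (Subtype.ext (Prod.ext comm comm'))] at key
  · simp only [derivForm, map_mul, hρY] at key
    exact key
  · have := congrArg TrivSqZeroExt.snd h
    rw [TrivSqZeroExt.snd_add, TrivSqZeroExt.snd_one, add_comm] at this
    exact eq_neg_of_add_eq_zero_left this

/-- The vector `s` enters the formula only through the derivative of `p + w`, which vanishes because
`p + w = 1` along `s`. -/
theorem cubeForm_eq_zero (B : CyclicPairing R M N Q) {x : CubeEdge → Rˣ} {s : CubeEdge → M}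
    (hs : s ∈ cubeLagrangianTangent x M) {t : CubeEdge → N} (ht : t ∈ cubeLagrangianTangent x N) :
    cubeForm B x s t = 0 := by
  obtain ⟨y, hy, hyx, hys⟩ := mem_tangentVectors_iff.mp hs
  obtain ⟨y', hy', hyx', hyt⟩ := mem_tangentVectors_iff.mp ht
  rw [mem_cubeLagrangian_iff_add_eq_one] at hy hy'
  obtain rfl := funext hys
  obtain rfl := funext hyt
  rw [cubeForm_eq B hy.1 hyx hy'.1 hyx' hy'.2, hy.2]
  simp

/-- The product `a4 b2` has arbitrary derivatives along the subvariety. -/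
theorem exists_mem_cubeLagrangian_snd_eq {x : CubeEdge → Rˣ} (hx : x ∈ cubeLagrangian R) (n : N) :
    ∃ y ∈ cubeLagrangian (TrivSqZeroExt R N), (∀ e, unitsFst R N (y e) = x e) ∧
      ((y a4 * y b2 : (TrivSqZeroExt R N)ˣ) : TrivSqZeroExt R N).snd = n := by
  rw [mem_cubeLagrangian_iff_add_eq_one] at hx
  have lift : ∀ (r : Rˣ) (n : N), ∃ r' : (TrivSqZeroExt R N)ˣ,
      (r' : TrivSqZeroExt R N) = TrivSqZeroExt.inl (r : R) + TrivSqZeroExt.inr n := fun r n =>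
    TrivSqZeroExt.isUnit_iff_isUnit_fst.mpr (by simp)
  obtain ⟨p, hp⟩ := lift (x a4 * x b2) n
  -- The derivative `-n` keeps `p + w = 1`; the free coordinates `b1`, `b2`, `b4` stay constant.
  obtain ⟨w, hw⟩ := lift (x b1 * x b4 * x b3 * x b2) (-n)
  obtain ⟨y1, h1⟩ := lift (x b1) 0
  obtain ⟨y2, h2⟩ := lift (x b2) 0
  obtain ⟨y4, h4⟩ := lift (x b4) 0
  have fst_eq : ∀ {r : Rˣ} {n : N} {r' : (TrivSqZeroExt R N)ˣ},
      (r' : TrivSqZeroExt R N) = TrivSqZeroExt.inl (r : R) + TrivSqZeroExt.inr n →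
      unitsFst R N r' = r := fun h => by
    ext; simp [val_unitsFst, h]
  refine ⟨cubePoint p w y1 y2 y4, cubePoint_mem_cubeLagrangian ?_ _ _ _, fun e => ?_, ?_⟩
  · rw [hp, hw]
    ext
    · simpa using hx.2
    · simp
  · rw [unitsFst_cubePoint, fst_eq hp, fst_eq hw, fst_eq h1, fst_eq h2, fst_eq h4,
      ← (eq_cubePoint_of_mem_cubeTorus hx.1).2]
  · have : cubePoint p w y1 y2 y4 a4 * cubePoint p w y1 y2 y4 b2 = p := by simp [cubePoint]
    rw [this, hp]
    simp

theorem mem_cubeLagrangianTangent_of_cubeForm_eq_zero {B : CyclicPairing R M N Q}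
    (hB : B.Nondegenerate) (h2 : ∀ m : M, m + m = 0 → m = 0) {x : CubeEdge → Rˣ}
    (hx : x ∈ cubeLagrangian R) {s : CubeEdge → M} (hs : s ∈ cubeTorusTangent x M)
    (h : ∀ t ∈ cubeLagrangianTangent x N, cubeForm B x s t = 0) :
    s ∈ cubeLagrangianTangent x M := by
  obtain ⟨y, hy, hyx, hys⟩ := mem_tangentVectors_iff.mp hs
  refine mem_tangentVectors_iff.mpr
    ⟨y, mem_cubeLagrangian_iff_add_eq_one.mpr ⟨hy, ?_⟩, hyx, hys⟩
  obtain rfl := funext hys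
  have hpair := hB _ fun n => by
    obtain ⟨y', hy', hyx', rfl⟩ := exists_mem_cubeLagrangian_snd_eq hx n
    have hy'' := mem_cubeLagrangian_iff_add_eq_one.mp hy'
    have := h _ (mem_tangentVectors_iff.mpr ⟨y', hy', hyx', fun _ => rfl⟩)
    rw [cubeForm_eq B hy hyx hy''.1 hyx' hy''.2] at this
    exact neg_eq_zero.mp this
  have comm := (eq_cubePoint_of_mem_cubeTorus hy).1
  have hxe := (mem_cubeLagrangian_iff_add_eq_one.mp hx).2
  have hp : unitsFst R M (y a4 * y b2) = x a4 * x b2 := by simp only [map_mul, hyx]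
  have hw : unitsFst R M (y b1 * y b4 * y b3 * y b2) = x b1 * x b4 * x b3 * x b2 := by
    simp only [map_mul, hyx]
  generalize y a4 * y b2 = p' at *
  generalize y b1 * y b4 * y b3 * y b2 = w' at *
  generalize x a4 * x b2 = p at *
  generalize x b1 * x b4 * x b3 * x b2 = w at *
  have hp' : (p' : TrivSqZeroExt R M).fst = p := congrArg Units.val hp
  have hw' : (w' : TrivSqZeroExt R M).fst = w := congrArg Units.val hw
  set m : M := ((p' : TrivSqZeroExt R M) + (w' : TrivSqZeroExt R M)).snd with hm
  have hwp : (w : R) = 1 - p := by rw [← hxe]; abel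
  -- This is the ε-part of `w' p' = p' w'` after substituting `w = 1 - p`.
  have hpm : (p : R) • m = m <• (p : R) := by
    have := congrArg (fun u : (TrivSqZeroExt R M)ˣ => (u : TrivSqZeroExt R M).snd) comm
    simp only [Units.val_mul, TrivSqZeroExt.snd_mul, hp', hw', hwp, sub_smul, one_smul,
      MulOpposite.op_sub, MulOpposite.op_one] at this
    rw [hm, TrivSqZeroExt.snd_add, smul_add, smul_add]
    grind
  have hwm : (w : R) • m = m <• (w : R) := by
    rw [hwp, sub_smul, MulOpposite.op_sub, sub_smul, hpm]; simp
  have inv_comm : ∀ {r : Rˣ}, (r : R) • m = m <• (r : R) →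
      ((r⁻¹ : Rˣ) : R) • m = m <• ((r⁻¹ : Rˣ) : R) := fun {r} hr => by
    have h1 : m = ((r⁻¹ : Rˣ) : R) • m <• (r : R) := by rw [← hr, smul_smul]; simp
    conv_rhs => rw [h1]
    rw [← smul_comm, smul_smul, ← MulOpposite.op_mul]
    simp
  have hk : ((p⁻¹ * w⁻¹ : Rˣ) : R) • m = m <• ((p⁻¹ * w⁻¹ : Rˣ) : R) := by
    rw [Units.val_mul, mul_smul, inv_comm hwm, smul_comm, inv_comm hpm, smul_smul,
      ← MulOpposite.op_mul]
  rw [← hk] at hpair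
  -- Now `k m + k m = 0` with `k = p⁻¹ w⁻¹` a unit.
  have hm0 : m = 0 := by
    have := h2 _ hpair
    rwa [← Units.smul_def, smul_eq_zero_iff_eq] at this
  ext
  · simp [hp', hw', hxe]
  · rw [← hm, hm0]; simp

end Tangent

theorem theoremS111 :
    Nonempty (cubeSymmetry ≃* alternatingGroup (Fin 4)) ∧
    ∀ (R : Type u) [Ring R],
      (∀ g ∈ cubeSymmetry, ∀ x : CubeEdge → Rˣ,
        (x ∈ cubeTorus R ↔ (fun e => x (g e)) ∈ cubeTorus R) ∧
        (x ∈ cubeLagrangian R ↔ (fun e => x (g e)) ∈ cubeLagrangian R)) ∧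
      ((cubeLagrangian R).Nonempty ↔ ∃ r : Rˣ, IsUnit (1 - (r : R))) ∧
      ∀ x ∈ cubeLagrangian R,
        ∀ (M : Type v) [AddCommGroup M] [Module R M] [Module Rᵐᵒᵖ M] [SMulCommClass R Rᵐᵒᵖ M]
          (N : Type w) [AddCommGroup N] [Module R N] [Module Rᵐᵒᵖ N] [SMulCommClass R Rᵐᵒᵖ N]
          (Q : Type z) [AddCommGroup Q] (B : CyclicPairing R M N Q),
          (∀ s ∈ cubeLagrangianTangent x M, ∀ t ∈ cubeLagrangianTangent x N,
            cubeForm B x s t = 0) ∧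
          (B.Nondegenerate → (∀ m : M, m + m = 0 → m = 0) →
            ∀ s ∈ cubeTorusTangent x M,
              (∀ t ∈ cubeLagrangianTangent x N, cubeForm B x s t = 0) →
                s ∈ cubeLagrangianTangent x M) := by
  refine ⟨nonempty_cubeSymmetry_mulEquiv, fun R _ => ⟨fun g hg x =>
    ⟨mem_of_comp_mem (fun _ h _ => comp_mem_cubeTorus h) hg,
      mem_of_comp_mem (fun _ h _ => comp_mem_cubeLagrangian h) hg⟩,
    cubeLagrangian_nonempty_iff, ?_⟩⟩
  intro x hx M _ _ _ _ N _ _ _ _ Q _ B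
  exact ⟨fun s hs t ht => cubeForm_eq_zero B hs ht,
    fun hB h2 s hs h => mem_cubeLagrangianTangent_of_cubeForm_eq_zero hB h2 hx hs h⟩
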